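/- Let $P(t)=a_0+a_1t+\cdots+a_dt^d$ be a real polynomial with $a_0=1$ and $a_i>0$ for all $0\le i\le d$, and let $$F_P(\mathbf x)=\prod_{i\ge 1}P(x_i)$$ in the ring of formal power series over $\mathbb R$ in countably many variables $\mathbf x=\{x_1,x_2,\ldots\}$. For a partition $\lambda$ with conjugate $\lambda'$ let $s_\lambda(\mathbf x)=\det\bigl(e_{\lambda'_i-i+j}(\mathbf x)\bigr)_{1\le i,j\le \lambda_1}$ be the Schur function, where $e_k$ is the $k$-th elementary symmetric function, $e_0=1$, and $e_k=0$ for $k<0$. Then the product $F_P$ converges coefficientwise and has a unique expansion $F_P=\sum_\lambda c_\lambda s_\lambda$ as a (possibly infinite) formal real linear combination of Schur functions; write $[s_\lambda]F_P=c_\lambda$. The following conditions are equivalent: 1. $[s_\lambda]F_P\ge 0$ for every partition $\lambda$ of length at most $2$; 2. $[s_{(k,k)}]F_P\ge 0$ for every integer $k\ge 1$; 3. $P$ is log-concave, i.e. $a_j^2\ge a_{j-1}a_{j+1}$ for all $1\le j\le d-1$; 4. $P$ is strongly log-concave, i.e. $a_ma_n\ge a_pa_q$ for all $0\le p<m\le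 n<q\le d$ with $m+n=p+q$. -/

import Mathlib

open scoped MvPowerSeries.WithPiTopology

noncomputable section

namespace TwoSchur

/-- Formal power series with real coefficients in the countably many variables `x_0, x_1, …`.
They carry the topology of coefficientwise convergence. -/
abbrev Series : Type := MvPowerSeries ℕ ℝ

open Classical in
/-- The elementary symmetric function `e_k`: the sum of all squarefree monomials of degree `k`. -/
def elem (k : ℕ) : Series := fun m => if (∀ i, m i ≤ 1) ∧ m.degree = k then 1 else 0

/-- `e_k` for an integer index, with `e_k = 0` for `k < 0`. -/
def elemInt (k : ℤ) : Series := if 0 ≤ k then elem k.toNat else 0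

/-- The Schur function `s_μ = det (e_{μ'_i - i + j})`, where `μ'` is the conjugate partition
(`μ'_i = μ.colLen i`) and the size of the determinant is the length `μ.rowLen 0` of `μ'`.
Partitions are Young diagrams; shifting both indices to start at `0` does not change `j - i`. -/
def schur (μ : YoungDiagram) : Series :=
  Matrix.det (Matrix.of fun i j : Fin (μ.rowLen 0) =>
    elemInt ((μ.colLen (i : ℕ) : ℤ) - ((i : ℕ) : ℤ) + ((j : ℕ) : ℤ)))

/-- `f = ∑_μ c_μ s_μ`, as a formal sum over all partitions. -/
def HasSchurExpansion (f : Series) (c : YoungDiagram → ℝ) : Prop :=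
  HasSum (fun μ : YoungDiagram => c μ • schur μ) f

open Classical in
/-- `[s_μ] f`: the coefficient of `s_μ` in the expansion of `f` in Schur functions
(`0` if there is no expansion). -/
def schurCoeff (μ : YoungDiagram) (f : Series) : ℝ :=
  if h : ∃ c, HasSchurExpansion f c then h.choose μ else 0

/-- `F_P = ∏_i P(x_i)`. -/
def prodSeries (P : Polynomial ℝ) : Series :=
  ∏' i : ℕ, Polynomial.aeval (MvPowerSeries.X i : Series) P

/-- The partition `(k, k)` (the empty partition for `k = 0`). -/
def twoRow (k : ℕ) : YoungDiagram :=
  YoungDiagram.ofRowLens [k, k] (by simp [List.sortedGE_iff_pairwise])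

/-- `a_j ^ 2 ≥ a_{j-1} a_{j+1}` for `1 ≤ j ≤ d - 1`. -/
def LogConcave (P : Polynomial ℝ) : Prop :=
  ∀ j : ℕ, 1 ≤ j → j + 1 ≤ P.natDegree →
    P.coeff (j - 1) * P.coeff (j + 1) ≤ P.coeff j ^ 2

/-- `a_m a_n ≥ a_p a_q` whenever `0 ≤ p < m ≤ n < q ≤ d` and `m + n = p + q`. -/
def StronglyLogConcave (P : Polynomial ℝ) : Prop :=
  ∀ p m n q : ℕ, p < m → m ≤ n → n < q → q ≤ P.natDegree → m + n = p + q →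
    P.coeff p * P.coeff q ≤ P.coeff m * P.coeff n

end TwoSchur

end

/-! Only two variables matter for partitions with at most two rows. Set all variables except
$x_0,x_1$ to zero and multiply by $x_0-x_1$: a Schur function with three or more rows vanishes,
while $s_\lambda$ with $\lambda=(\lambda_1,\lambda_2)$ becomes
$x_0^{\lambda_1+1}x_1^{\lambda_2}-x_0^{\lambda_2}x_1^{\lambda_1+1}$. Reading off one coefficient of
$(x_0-x_1)P(x_0)P(x_1)$ gives $c_\lambda=a_{\lambda_1}a_{\lambda_2}-a_{\lambda_1+1}a_{\lambda_2-1}$,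
the last term being absent if $\lambda_2=0$ (`alternant_schur`, `schurCoeff_prodSeries`). For
$\lambda=(k,k)$ this is the log-concavity defect at $k$; for general $\lambda$ it is an instance of
strong log-concavity, which follows from log-concavity because the ratios $a_{i+1}/a_i$ of positive
coefficients are non-increasing.

Existence and uniqueness of the expansion hold for every symmetric series. By homogeneity the
problem splits by degree, by symmetry it suffices to compare coefficients at weakly decreasing
exponent vectors, and there the finite matrix of Schur coefficients is unitriangular for the
lexicographic order (`existsUnique_solution`). -/

namespace TwoSchur

/-! ### Determinants in the $e_k$, in general and for two variables. -/

section JacobiTrudi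

variable {R S : Type*} [CommRing R] [CommRing S]

/-- The determinant `det (e_{α_i - i + j})` of size `M`. -/
def jt (e : ℤ → R) (α : ℕ → ℤ) (M : ℕ) : R :=
  Matrix.det (Matrix.of fun i j : Fin M => e (α i - ((i : ℕ) : ℤ) + ((j : ℕ) : ℤ)))

theorem jt_congr {e : ℤ → R} {α β : ℕ → ℤ} {M : ℕ} (h : ∀ i < M, α i = β i) :
    jt e α M = jt e β M := by
  unfold jt
  congr 1
  ext i j
  simp [h i i.2]

theorem map_jt (f : R →+* S) (e : ℤ → R) (α : ℕ → ℤ) (M : ℕ) :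
    f (jt e α M) = jt (fun k => f (e k)) α M := by
  unfold jt
  rw [RingHom.map_det]
  rfl

theorem jt_zero (e : ℤ → R) (α : ℕ → ℤ) : jt e α 0 = 1 := by
  simp [jt]

/-- The last row is $(0,\dots,0,e_0)$, so empty columns of the diagram may be dropped. -/
theorem jt_succ_of_eq_zero {e : ℤ → R} (h0 : e 0 = 1) (hneg : ∀ k < 0, e k = 0) {α : ℕ → ℤ}
    {M : ℕ} (hα : α M = 0) : jt e α (M + 1) = jt e α M := by
  unfold jt
  rw [Matrix.det_succ_row _ (Fin.last M), Finset.sum_eq_single (Fin.last M)]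
  · simp only [Matrix.of_apply, Fin.val_last, hα]
    rw [show (0 : ℤ) - M + M = 0 by ring, h0, ← two_mul, pow_mul]
    simp only [even_two, Even.neg_pow, one_pow, one_mul, Fin.succAbove_last]
    rfl
  · intro j _ hj
    have : (j : ℕ) < M := Fin.val_lt_last hj
    simp only [Matrix.of_apply, Fin.val_last, hα]
    rw [hneg _ (by omega)]
    simp
  · simp

theorem jt_eq_of_le {e : ℤ → R} (h0 : e 0 = 1) (hneg : ∀ k < 0, e k = 0) {α : ℕ → ℤ}
    {M N : ℕ} (hMN : M ≤ N) (hα : ∀ i, M ≤ i → α i = 0) : jt e α N = jt e α M := by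
  induction N, hMN using Nat.le_induction with
  | base => rfl
  | succ n hn ih => rw [jt_succ_of_eq_zero h0 hneg (hα n hn), ih]

section TwoVariables

variable {e : ℤ → R} {x y : R}

theorem jt_eq_zero_of_lt (hbig : ∀ k, 2 < k → e k = 0) {α : ℕ → ℤ} {M : ℕ} (hα : 2 < α 0)
    (hM : 0 < M) : jt e α M = 0 := by
  obtain ⟨M, rfl⟩ := Nat.exists_eq_succ_of_ne_zero hM.ne'
  refine Matrix.det_eq_zero_of_row_eq_zero 0 fun j => hbig _ ?_
  simp
  omega

/-- The first row is $(e_2,0,\dots,0)$: each column of length 2 splits off a factor $xy$. -/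
theorem jt_succ_of_eq_two (h2 : e 2 = x * y) (hbig : ∀ k, 2 < k → e k = 0) {α : ℕ → ℤ} {M : ℕ}
    (hα : α 0 = 2) : jt e α (M + 1) = x * y * jt e (fun i => α (i + 1)) M := by
  unfold jt
  rw [Matrix.det_succ_row_zero, Finset.sum_eq_single 0]
  · simp only [Fin.val_zero, pow_zero, one_mul, Matrix.of_apply, hα]
    rw [show (2 : ℤ) - ((0 : ℕ) : ℤ) + ((0 : ℕ) : ℤ) = 2 by norm_num, h2]
    congr 2
    ext i j
    simp only [Matrix.submatrix_apply, Matrix.of_apply, Fin.zero_succAbove, Fin.val_succ]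
    congr 1
    push_cast
    ring
  · intro j _ hj
    have : 0 < (j : ℕ) := Nat.pos_of_ne_zero fun h => hj (Fin.ext h)
    simp only [Fin.val_zero, Matrix.of_apply, hα]
    rw [hbig _ (by omega)]
    simp
  · simp

/-- The matrix is tridiagonal with $e_1$ on the diagonal, $e_2$ above and $e_0=1$ below, so this is
the continuant recurrence; its solution is the complete symmetric polynomial $h_a(x,y)$. -/
theorem jt_one_succ_succ (h0 : e 0 = 1) (h1 : e 1 = x + y) (h2 : e 2 = x * y)
    (hneg : ∀ k < 0, e k = 0) (hbig : ∀ k, 2 < k → e k = 0) (a : ℕ) :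
    jt e (fun _ => 1) (a + 2) = (x + y) * jt e (fun _ => 1) (a + 1)
      - x * y * jt e (fun _ => 1) a := by
  have key : ∀ j : Fin a, e (1 - ((0 : ℕ) : ℤ) + ((j.succ.succ : Fin (a + 2)) : ℕ)) = 0 := by
    intro j
    apply hbig
    simp
    omega
  unfold jt
  rw [Matrix.det_succ_row_zero, Fin.sum_univ_succ, Fin.sum_univ_succ, Finset.sum_eq_zero, add_zero,
    sub_eq_add_neg]
  · congr 1
    · simp only [Fin.val_zero, pow_zero, one_mul, Matrix.of_apply]
      rw [show (1 : ℤ) - ((0 : ℕ) : ℤ) + ((0 : ℕ) : ℤ) = 1 by norm_num, h1]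
      congr 2
      ext i j
      simp only [Matrix.submatrix_apply, Matrix.of_apply, Fin.zero_succAbove, Fin.val_succ]
      congr 1
      push_cast
      ring
    · simp only [Fin.succ_zero_eq_one, Fin.val_one, pow_one, Matrix.of_apply, Fin.val_zero]
      rw [show (1 : ℤ) - ((0 : ℕ) : ℤ) + ((1 : ℕ) : ℤ) = 2 by norm_num, h2,
        Matrix.det_succ_column_zero, Finset.sum_eq_single 0]
      · simp only [Fin.val_zero, pow_zero, one_mul, Matrix.submatrix_apply, Matrix.of_apply,
          Fin.val_succ]
        rw [show ((1 : Fin (a + 2)).succAbove (0 : Fin (a + 1)) : ℕ) = 0 by simp]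
        rw [show (1 : ℤ) - ((0 + 1 : ℕ) : ℤ) + ((0 : ℕ) : ℤ) = 0 by norm_num, h0,
          one_mul, neg_one_mul, neg_mul]
        congr 3
        ext i j
        simp
        congr 1
        ring
      · intro i _ hi
        have : 0 < (i : ℕ) := Nat.pos_of_ne_zero fun h => hi (Fin.ext h)
        simp only [Matrix.submatrix_apply, Matrix.of_apply, Fin.val_succ]
        rw [show ((1 : Fin (a + 2)).succAbove (0 : Fin (a + 1)) : ℕ) = 0 by simp, hneg _ (by omega)]
        simp
      · simp
  · intro j _
    simp only [Matrix.of_apply, Fin.val_zero]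
    rw [key]
    simp

theorem sub_mul_jt_one (h0 : e 0 = 1) (h1 : e 1 = x + y) (h2 : e 2 = x * y)
    (hneg : ∀ k < 0, e k = 0) (hbig : ∀ k, 2 < k → e k = 0) (a : ℕ) :
    (x - y) * jt e (fun _ => 1) a = x ^ (a + 1) - y ^ (a + 1) := by
  induction a using Nat.twoStepInduction with
  | zero => simp [jt_zero]
  | one => simp [jt, h1]; ring
  | more a ih1 ih2 =>
    rw [jt_one_succ_succ h0 h1 h2 hneg hbig]
    linear_combination (x + y) * ih2 - x * y * ih1

theorem sub_mul_jt_two_one (h0 : e 0 = 1) (h1 : e 1 = x + y) (h2 : e 2 = x * y)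
    (hneg : ∀ k < 0, e k = 0) (hbig : ∀ k, 2 < k → e k = 0) (q a : ℕ) (α : ℕ → ℤ)
    (hα2 : ∀ i < q, α i = 2) (hα1 : ∀ i, q ≤ i → i < q + a → α i = 1) :
    (x - y) * jt e α (q + a) = (x * y) ^ q * (x ^ (a + 1) - y ^ (a + 1)) := by
  induction q generalizing α with
  | zero =>
    rw [zero_add, jt_congr (β := fun _ => 1) fun i hi => hα1 i (by simp) (by simpa using hi),
      sub_mul_jt_one h0 h1 h2 hneg hbig]
    ring
  | succ q ih =>
    rw [show q + 1 + a = q + a + 1 by ring, jt_succ_of_eq_two h2 hbig (hα2 0 (by simp))]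
    have := ih (fun i => α (i + 1)) (fun i hi => hα2 _ (by omega))
      (fun i hi hi' => hα1 _ (by omega) (by omega))
    linear_combination x * y * this

end TwoVariables

end JacobiTrudi

theorem schur_eq_jt (μ : YoungDiagram) :
    schur μ = jt elemInt (fun i => (μ.colLen i : ℤ)) (μ.rowLen 0) := rfl

theorem elemInt_natCast (k : ℕ) : elemInt k = elem k := by simp [elemInt]

theorem elemInt_of_neg {k : ℤ} (hk : k < 0) : elemInt k = 0 := by
  simp [elemInt, hk.not_ge]

open Classical in
theorem coeff_elem (k : ℕ) (m : ℕ →₀ ℕ) :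
    MvPowerSeries.coeff m (elem k) = if (∀ i, m i ≤ 1) ∧ m.degree = k then 1 else 0 := rfl

/-! ### Homogeneity of Schur functions. -/

section Homogeneous

/-- All monomials of `f` have degree `d`. -/
def HomogeneousOf (f : Series) (d : ℤ) : Prop :=
  ∀ m, MvPowerSeries.coeff m f ≠ 0 → (m.degree : ℤ) = d

theorem homogeneousOf_elemInt (k : ℤ) : HomogeneousOf (elemInt k) k := by
  intro m hm
  rcases lt_or_ge k 0 with hk | hk
  · simp [elemInt_of_neg hk] at hm
  · lift k to ℕ using hk
    rw [elemInt_natCast, coeff_elem] at hm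
    simp only [ne_eq, ite_eq_right_iff, Classical.not_imp] at hm
    exact_mod_cast hm.1.2

theorem HomogeneousOf.mul {f g : Series} {a b : ℤ} (hf : HomogeneousOf f a)
    (hg : HomogeneousOf g b) : HomogeneousOf (f * g) (a + b) := by
  intro m hm
  rw [MvPowerSeries.coeff_mul] at hm
  obtain ⟨p, hp, h⟩ := Finset.exists_ne_zero_of_sum_ne_zero hm
  rw [Finset.HasAntidiagonal.mem_antidiagonal] at hp
  rw [← hp, map_add, Nat.cast_add, hf _ (left_ne_zero_of_mul h), hg _ (right_ne_zero_of_mul h)]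

theorem homogeneousOf_prod {ι : Type*} (s : Finset ι) (f : ι → Series) (d : ι → ℤ)
    (h : ∀ i ∈ s, HomogeneousOf (f i) (d i)) : HomogeneousOf (∏ i ∈ s, f i) (∑ i ∈ s, d i) := by
  classical
  induction s using Finset.induction_on with
  | empty =>
    intro m hm
    rw [Finset.prod_empty, MvPowerSeries.coeff_one] at hm
    simp_all
  | insert i s hi ih =>
    rw [Finset.prod_insert hi, Finset.sum_insert hi]
    exact (h i (by simp)).mul (ih fun j hj => h j (by simp [hj]))

/-- In each Leibniz term the shifts $-i+j$ cancel, since a permutation preserves the sum of indices.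
-/
theorem homogeneousOf_jt (α : ℕ → ℤ) (M : ℕ) :
    HomogeneousOf (jt elemInt α M) (∑ i ∈ Finset.range M, α i) := by
  intro m hm
  rw [jt, Matrix.det_apply, map_sum] at hm
  obtain ⟨σ, -, h⟩ := Finset.exists_ne_zero_of_sum_ne_zero hm
  rw [Units.smul_def, zsmul_eq_mul, ← map_intCast (MvPowerSeries.C (σ := ℕ) (R := ℝ)),
    MvPowerSeries.coeff_C_mul] at h
  rw [homogeneousOf_prod _ _ _ (fun i _ => homogeneousOf_elemInt _) m (right_ne_zero_of_mul h),
    Finset.sum_add_distrib, Finset.sum_sub_distrib,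
    Equiv.sum_comp σ (fun i : Fin M => ((i : ℕ) : ℤ)),
    Equiv.sum_comp σ (fun i : Fin M => α i), sub_add_cancel, Finset.sum_range]

theorem card_eq_sum_colLen (μ : YoungDiagram) :
    μ.card = ∑ i ∈ Finset.range (μ.rowLen 0), μ.colLen i := by
  rw [YoungDiagram.card, Finset.card_eq_sum_card_fiberwise (f := Prod.snd)
    (t := Finset.range (μ.rowLen 0))]
  · exact Finset.sum_congr rfl fun i _ => (μ.colLen_eq_card).symm
  · rintro ⟨i, j⟩ h
    have h := μ.up_left_mem (Nat.zero_le i) le_rfl ((μ.mem_cells _).1 h)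
    simpa using YoungDiagram.mem_iff_lt_rowLen.1 h

theorem degree_eq_card_of_coeff_schur_ne_zero {μ : YoungDiagram} {m : ℕ →₀ ℕ}
    (h : MvPowerSeries.coeff m (schur μ) ≠ 0) : m.degree = μ.card := by
  rw [schur_eq_jt] at h
  have := homogeneousOf_jt _ _ m h
  rw [card_eq_sum_colLen]
  exact_mod_cast this

end Homogeneous

/-! ### Symmetry of Schur functions. -/

section Symmetric

/-- Coefficients are invariant under permutations of the variables. -/
def Symm (f : Series) : Prop :=
  ∀ (σ : Equiv.Perm ℕ) (m : ℕ →₀ ℕ),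
    MvPowerSeries.coeff (m.equivMapDomain σ) f = MvPowerSeries.coeff m f

/-- Renaming variables is a ring homomorphism, so in this form symmetry passes from the $e_k$ to
determinants. -/
theorem symm_iff_rename (f : Series) :
    Symm f ↔ ∀ σ : Equiv.Perm ℕ, MvPowerSeries.rename σ f = f := by
  have key (σ : Equiv.Perm ℕ) (m : ℕ →₀ ℕ) :
      MvPowerSeries.coeff (m.equivMapDomain σ) (MvPowerSeries.rename σ f)
        = MvPowerSeries.coeff m f := by
    have := MvPowerSeries.coeff_embDomain_rename σ.toEmbedding f m
    rw [Finsupp.embDomain_eq_mapDomain] at this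
    rw [Finsupp.equivMapDomain_eq_mapDomain]
    exact this
  constructor
  · intro h σ
    ext m
    have h1 := key σ (m.equivMapDomain σ.symm)
    have h2 := h σ (m.equivMapDomain σ.symm)
    rw [← Finsupp.equivMapDomain_trans, Equiv.symm_trans_self, Finsupp.equivMapDomain_refl] at h1 h2
    rw [h1, h2]
  · intro h σ m
    have := key σ m
    rwa [h σ] at this

theorem symm_elemInt (k : ℤ) : Symm (elemInt k) := by
  intro σ m
  rcases lt_or_ge k 0 with hk | hk
  · simp [elemInt_of_neg hk]
  · lift k to ℕ using hk
    rw [elemInt_natCast, coeff_elem, coeff_elem]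
    have h1 : (m.equivMapDomain σ).degree = m.degree := by
      rw [Finsupp.equivMapDomain_eq_mapDomain, Finsupp.degree_mapDomain]
    have h2 : (∀ i, (m.equivMapDomain σ) i ≤ 1) ↔ ∀ i, m i ≤ 1 := by
      simp only [Finsupp.equivMapDomain_apply]
      exact σ.symm.forall_congr_right (q := fun i => m i ≤ 1)
    by_cases h : (∀ i, m i ≤ 1) ∧ m.degree = k
    · rw [if_pos h, if_pos ⟨h2.2 h.1, h1.trans h.2⟩]
    · rw [if_neg h, if_neg fun h' => h ⟨h2.1 h'.1, h1.symm.trans h'.2⟩]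

theorem symm_schur (μ : YoungDiagram) : Symm (schur μ) := by
  rw [symm_iff_rename]
  intro σ
  rw [schur_eq_jt]
  have := map_jt (MvPowerSeries.rename σ : Series →ₐ[ℝ] Series).toRingHom elemInt
    (fun i => (μ.colLen i : ℤ)) (μ.rowLen 0)
  refine this.trans ?_
  congr 1
  ext1 k
  exact (symm_iff_rename _).1 (symm_elemInt k) σ

end Symmetric

/-! ### Restriction to finitely many variables. -/

section Truncation

/-- The elementary symmetric polynomials in `N` variables, for integer indices. -/
noncomputable def esymmInt (N : ℕ) (k : ℤ) : MvPolynomial (Fin N) ℝ :=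
  if 0 ≤ k then MvPolynomial.esymm (Fin N) ℝ k.toNat else 0

theorem esymmInt_natCast (N k : ℕ) : esymmInt N k = MvPolynomial.esymm (Fin N) ℝ k := by
  simp [esymmInt]

theorem esymmInt_zero (N : ℕ) : esymmInt N 0 = 1 := by simp [esymmInt]

theorem esymmInt_of_neg (N : ℕ) {k : ℤ} (hk : k < 0) : esymmInt N k = 0 := by
  simp [esymmInt, hk.not_ge]

open Classical in
theorem coeff_esymm {σ : Type*} [Fintype σ] (k : ℕ) (m : σ →₀ ℕ) :
    MvPolynomial.coeff m (MvPolynomial.esymm σ ℝ k)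
      = if (∀ i, m i ≤ 1) ∧ m.degree = k then 1 else 0 := by
  have hval (t : Finset σ) (i : σ) :
      (∑ j ∈ t, Finsupp.single j 1 : σ →₀ ℕ) i = if i ∈ t then 1 else 0 := by
    simp [Finsupp.finsetSum_apply, Finsupp.single_apply]
  rw [MvPolynomial.esymm_eq_sum_monomial, MvPolynomial.coeff_sum]
  simp only [MvPolynomial.coeff_monomial]
  split_ifs with h
  · have hm : (∑ j ∈ m.support, Finsupp.single j 1 : σ →₀ ℕ) = m := by
      ext i
      rw [hval]
      have := h.1 i
      split_ifs with h' <;> simp at h' <;> omega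
    rw [Finset.sum_eq_single m.support, if_pos hm]
    · intro t _ ht
      rw [if_neg]
      rintro rfl
      apply ht
      ext i
      rw [Finsupp.mem_support_iff, hval]
      simp
    · intro hn
      refine absurd ?_ hn
      rw [Finset.mem_powersetCard_univ, ← h.2, Finsupp.degree_apply, Finset.card_eq_sum_ones]
      refine Finset.sum_congr rfl fun i hi => ?_
      have := h.1 i
      rw [Finsupp.mem_support_iff] at hi
      omega
  · refine Finset.sum_eq_zero fun t ht => if_neg ?_
    rintro rfl
    apply h
    refine ⟨fun i => ?_, ?_⟩
    · rw [hval]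
      split_ifs <;> simp
    · rw [map_sum]
      simpa using ht

/-- Squarefree monomials are split by whether they contain the first variable. -/
theorem finSuccEquiv_esymmInt (N : ℕ) (k : ℤ) :
    MvPolynomial.finSuccEquiv ℝ N (esymmInt (N + 1) k)
      = Polynomial.X * Polynomial.C (esymmInt N (k - 1)) + Polynomial.C (esymmInt N k) := by
  rcases lt_or_ge k 0 with hk | hk
  · simp [esymmInt_of_neg _ hk, esymmInt_of_neg N (show k - 1 < 0 by omega)]
  lift k to ℕ using hk
  ext i m
  rw [MvPolynomial.finSuccEquiv_coeff_coeff, esymmInt_natCast, coeff_esymm, esymmInt_natCast]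
  have hdeg : (m.cons i).degree = i + m.degree := by
    simp [Finsupp.degree_eq_sum, Fin.sum_univ_succ]
  have hall : (∀ j, m.cons i j ≤ 1) ↔ i ≤ 1 ∧ ∀ j, m j ≤ 1 := by
    simp [Fin.forall_fin_succ]
  simp only [hdeg, hall]
  rcases i with _ | _ | i
  · simp [coeff_esymm]
  · rcases k with _ | k
    · simp [esymmInt_of_neg, Polynomial.coeff_one]
    · simp [esymmInt_natCast, coeff_esymm, Polynomial.coeff_C_succ, add_comm (1 : ℕ)]
  · simp

/-- Setting all variables but the first `N` to zero. -/
noncomputable def truncate (N : ℕ) : Series →ₐ[ℝ] MvPowerSeries (Fin N) ℝ :=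
  MvPowerSeries.killCompl Fin.valEmbedding

theorem coeff_truncate (N : ℕ) (f : Series) (m : Fin N →₀ ℕ) :
    MvPowerSeries.coeff m (truncate N f)
      = MvPowerSeries.coeff (m.embDomain Fin.valEmbedding) f :=
  MvPowerSeries.coeff_killCompl f m

theorem truncate_elemInt (N : ℕ) (k : ℤ) :
    truncate N (elemInt k) = (esymmInt N k : MvPowerSeries (Fin N) ℝ) := by
  rcases lt_or_ge k 0 with hk | hk
  · simp [elemInt_of_neg hk, esymmInt_of_neg N hk]
  lift k to ℕ using hk
  ext m
  rw [coeff_truncate, elemInt_natCast, coeff_elem, esymmInt_natCast, MvPolynomial.coeff_coe,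
    coeff_esymm]
  have h1 : (m.embDomain Fin.valEmbedding).degree = m.degree := by
    rw [Finsupp.embDomain_eq_mapDomain, Finsupp.degree_mapDomain]
  have h2 : (∀ i, (m.embDomain Fin.valEmbedding) i ≤ 1) ↔ ∀ i, m i ≤ 1 := by
    constructor
    · intro h i
      have := h (Fin.valEmbedding i)
      rwa [Finsupp.embDomain_apply_self] at this
    · intro h i
      by_cases hi : i ∈ Set.range (Fin.valEmbedding (n := N))
      · obtain ⟨j, rfl⟩ := hi
        rw [Finsupp.embDomain_apply_self]
        exact h j
      · rw [Finsupp.embDomain_of_notMem_range _ _ _ hi]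
        simp
  simp only [h1, h2]
  congr

theorem truncate_schur (N : ℕ) (μ : YoungDiagram) :
    truncate N (schur μ)
      = ((jt (esymmInt N) (fun i => (μ.colLen i : ℤ)) (μ.rowLen 0) : MvPolynomial (Fin N) ℝ) :
        MvPowerSeries (Fin N) ℝ) := by
  have h1 := map_jt (truncate N).toRingHom elemInt (fun i => (μ.colLen i : ℤ)) (μ.rowLen 0)
  have h2 := map_jt (MvPolynomial.coeToMvPowerSeries.ringHom (σ := Fin N) (R := ℝ)) (esymmInt N)
    (fun i => (μ.colLen i : ℤ)) (μ.rowLen 0)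
  simp only [AlgHom.toRingHom_eq_coe, RingHom.coe_coe,
    MvPolynomial.coeToMvPowerSeries.ringHom_apply] at h1 h2
  rw [schur_eq_jt, h1, h2]
  simp only [truncate_elemInt]

end Truncation

/-! ### Lexicographic unitriangularity of Schur coefficients. -/

section Triangularity

/-- By the splitting of $e_k$ the matrix is $XA+B$ with $X$ the first variable, so the coefficient
of $X^M$ is $\det A$. Lowering every column by one removes the first row of the diagram, which
drives the inductions below. -/
theorem finSuccEquiv_jt (N M : ℕ) (α : ℕ → ℤ) :
    (MvPolynomial.finSuccEquiv ℝ N (jt (esymmInt (N + 1)) α M)).natDegree ≤ M ∧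
    (MvPolynomial.finSuccEquiv ℝ N (jt (esymmInt (N + 1)) α M)).coeff M
      = jt (esymmInt N) (fun i => α i - 1) M := by
  have h := map_jt (MvPolynomial.finSuccEquiv ℝ N).toRingHom (esymmInt (N + 1)) α M
  let A : Matrix (Fin M) (Fin M) (MvPolynomial (Fin N) ℝ) :=
    Matrix.of fun i j => esymmInt N (α i - 1 - ((i : ℕ) : ℤ) + ((j : ℕ) : ℤ))
  let B : Matrix (Fin M) (Fin M) (MvPolynomial (Fin N) ℝ) :=
    Matrix.of fun i j => esymmInt N (α i - ((i : ℕ) : ℤ) + ((j : ℕ) : ℤ))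
  have key : MvPolynomial.finSuccEquiv ℝ N (jt (esymmInt (N + 1)) α M) =
      Matrix.det ((Polynomial.X : Polynomial (MvPolynomial (Fin N) ℝ)) • A.map Polynomial.C
        + B.map Polynomial.C) := by
    refine h.trans ?_
    unfold jt
    congr 1
    ext1 i j
    refine (finSuccEquiv_esymmInt N _).trans ?_
    simp only [Matrix.add_apply, Matrix.smul_apply, Matrix.map_apply, A, B, Matrix.of_apply,
      smul_eq_mul]
    congr 4
    ring
  rw [key]
  have h1 := Polynomial.natDegree_det_X_add_C_le A B
  have h2 := Polynomial.coeff_det_X_add_C_card A B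
  rw [Fintype.card_fin] at h1 h2
  exact ⟨h1, h2⟩

/-- The sequences `α` and `ρ` are the column and row lengths of a common diagram. -/
def Conjugate (α ρ : ℕ → ℕ) : Prop := ∀ i k, k < α i ↔ i < ρ k

theorem Conjugate.shift {α ρ : ℕ → ℕ} (h : Conjugate α ρ) :
    Conjugate (fun i => α i - 1) (fun k => ρ (k + 1)) := by
  intro i k
  rw [← h i (k + 1)]
  exact Nat.lt_sub_iff_add_lt

/-- After the first row is removed, columns of length 1 become empty and the determinant shrinks
from size `ρ 0` to `ρ 1`. Truncated subtraction is harmless because `α i` is positive for `i < ρ 0`.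
-/
theorem Conjugate.jt_shift {α ρ : ℕ → ℕ} (h : Conjugate α ρ) (N : ℕ) :
    jt (esymmInt N) (fun i => (α i : ℤ) - 1) (ρ 0)
      = jt (esymmInt N) (fun i => ((α i - 1 : ℕ) : ℤ)) (ρ 1) := by
  have hpos (i : ℕ) : 0 < α i ↔ i < ρ 0 := h i 0
  have h1 (i : ℕ) : 1 < α i ↔ i < ρ 1 := h i 1
  rw [jt_congr (β := fun i => ((α i - 1 : ℕ) : ℤ))]
  · refine jt_eq_of_le (esymmInt_zero N) (fun k hk => esymmInt_of_neg N hk) ?_ ?_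
    · by_contra! hlt
      have := (h1 (ρ 0)).2 hlt
      have := (hpos (ρ 0)).1 (by omega)
      omega
    · intro i hi
      have := mt (h1 i).1 (by omega)
      simp only [Nat.cast_eq_zero]
      omega
  · intro i hi
    have := (hpos i).2 hi
    omega

theorem coeff_jt_eq_one {N : ℕ} {α ρ : ℕ → ℕ} (h : Conjugate α ρ) (m : Fin N →₀ ℕ)
    (hm : ∀ i : Fin N, m i = ρ i) (hN : ρ N = 0) :
    MvPolynomial.coeff m (jt (esymmInt N) (fun i => (α i : ℤ)) (ρ 0)) = 1 := by
  induction N generalizing α ρ with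
  | zero =>
    rw [hN, jt_zero, Subsingleton.elim m 0, MvPolynomial.coeff_zero_one]
  | succ N ih =>
    rw [← m.cons_tail, ← MvPolynomial.finSuccEquiv_coeff_coeff, hm 0, Fin.val_zero,
      (finSuccEquiv_jt N _ _).2, h.jt_shift]
    exact ih h.shift m.tail (fun i => by simpa [Finsupp.tail_apply] using hm i.succ) hN

theorem lex_of_coeff_jt_ne_zero {N : ℕ} {α ρ : ℕ → ℕ} (h : Conjugate α ρ) (m : Fin N →₀ ℕ)
    (hm : MvPolynomial.coeff m (jt (esymmInt N) (fun i => (α i : ℤ)) (ρ 0)) ≠ 0) :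
    (∀ i : Fin N, m i = ρ i) ∨ ∃ k : Fin N, (∀ i < k, m i = ρ i) ∧ m k < ρ k := by
  induction N generalizing α ρ with
  | zero => exact Or.inl fun i => i.elim0
  | succ N ih =>
    rw [← m.cons_tail, ← MvPolynomial.finSuccEquiv_coeff_coeff] at hm
    rcases lt_trichotomy (m 0) (ρ 0) with hlt | heq | hgt
    · exact Or.inr ⟨0, by simp, by simpa using hlt⟩
    · rw [heq, (finSuccEquiv_jt N _ _).2, h.jt_shift] at hm
      rcases ih h.shift m.tail hm with h1 | ⟨k, h1, h2⟩
      · exact Or.inl (Fin.cases (by simpa using heq) fun i => by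
          simpa [Finsupp.tail_apply] using h1 i)
      · refine Or.inr ⟨k.succ, fun i => ?_, by simpa [Finsupp.tail_apply] using h2⟩
        refine Fin.cases (fun _ => by simpa using heq) (fun i hi => ?_) i
        simpa [Finsupp.tail_apply] using h1 i (by simpa using hi)
    · rw [Polynomial.coeff_eq_zero_of_natDegree_lt ((finSuccEquiv_jt N _ _).1.trans_lt hgt)] at hm
      simp at hm

theorem conjugate_colLen_rowLen (μ : YoungDiagram) : Conjugate μ.colLen μ.rowLen := fun _ _ =>
  YoungDiagram.mem_iff_lt_colLen.symm.trans YoungDiagram.mem_iff_lt_rowLen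

theorem rowLen_eq_zero_of_le (μ : YoungDiagram) {i : ℕ} (hi : μ.colLen 0 ≤ i) : μ.rowLen i = 0 := by
  by_contra h
  have := (conjugate_colLen_rowLen μ 0 i).2 (Nat.pos_of_ne_zero h)
  omega

/-- The exponent vector of the monomial `∏ x_i ^ μ_i`. -/
noncomputable def rowExp (μ : YoungDiagram) : ℕ →₀ ℕ :=
  Finsupp.onFinset (Finset.range (μ.colLen 0)) μ.rowLen fun i hi => by
    rw [Finset.mem_range]
    by_contra! h
    exact hi (rowLen_eq_zero_of_le μ h)

theorem rowExp_apply (μ : YoungDiagram) (i : ℕ) : rowExp μ i = μ.rowLen i := rfl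

theorem rowLen_injective : Function.Injective YoungDiagram.rowLen := by
  intro μ ν h
  ext ⟨i, j⟩
  rw [YoungDiagram.mem_cells, YoungDiagram.mem_cells, YoungDiagram.mem_iff_lt_rowLen,
    YoungDiagram.mem_iff_lt_rowLen, h]

theorem exists_embDomain_eq {N : ℕ} (m : ℕ →₀ ℕ) (hm : ∀ i, N ≤ i → m i = 0) :
    ∃ m' : Fin N →₀ ℕ, m'.embDomain Fin.valEmbedding = m ∧ ∀ i : Fin N, m' i = m i := by
  refine ⟨Finsupp.equivFunOnFinite.symm fun i => m i, ?_, fun i => rfl⟩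
  ext i
  by_cases hi : i < N
  · have := Finsupp.embDomain_apply_self Fin.valEmbedding
      (Finsupp.equivFunOnFinite.symm fun i : Fin N => m i) ⟨i, hi⟩
    exact this
  · rw [Finsupp.embDomain_of_notMem_range, hm i (not_lt.1 hi)]
    rintro ⟨j, rfl⟩
    exact hi j.2

theorem coeff_schur_eq_coeff_jt {N : ℕ} (μ : YoungDiagram) (m : Fin N →₀ ℕ) :
    MvPowerSeries.coeff (m.embDomain Fin.valEmbedding) (schur μ)
      = MvPolynomial.coeff m (jt (esymmInt N) (fun i => (μ.colLen i : ℤ)) (μ.rowLen 0)) := by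
  rw [← coeff_truncate, truncate_schur, MvPolynomial.coeff_coe]

theorem coeff_rowExp_schur_self (μ : YoungDiagram) :
    MvPowerSeries.coeff (rowExp μ) (schur μ) = 1 := by
  obtain ⟨m, hm, hm'⟩ := exists_embDomain_eq (N := μ.colLen 0) (rowExp μ)
    fun i hi => rowLen_eq_zero_of_le μ hi
  rw [← hm, coeff_schur_eq_coeff_jt]
  exact coeff_jt_eq_one (conjugate_colLen_rowLen μ) m hm' (rowLen_eq_zero_of_le μ le_rfl)

theorem toLex_rowLen_le_of_coeff_schur_ne_zero {μ ν : YoungDiagram}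
    (h : MvPowerSeries.coeff (rowExp ν) (schur μ) ≠ 0) : toLex ν.rowLen ≤ toLex μ.rowLen := by
  obtain ⟨m, hm, hm'⟩ := exists_embDomain_eq (N := max (μ.colLen 0) (ν.colLen 0)) (rowExp ν)
    fun i hi => rowLen_eq_zero_of_le ν (by omega)
  rw [← hm, coeff_schur_eq_coeff_jt] at h
  rcases lex_of_coeff_jt_ne_zero (conjugate_colLen_rowLen μ) m h with h | ⟨k, h1, h2⟩
  · refine le_of_eq (congrArg toLex (funext fun i => ?_))
    by_cases hi : i < max (μ.colLen 0) (ν.colLen 0)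
    · exact (hm' ⟨i, hi⟩).symm.trans (h ⟨i, hi⟩)
    · rw [rowLen_eq_zero_of_le ν (by omega), rowLen_eq_zero_of_le μ (by omega)]
  · refine le_of_lt ⟨k, fun j hj => ?_, ?_⟩
    · have := h1 ⟨j, hj.trans k.2⟩ hj
      rw [hm'] at this
      exact this
    · rw [hm'] at h2
      exact h2

end Triangularity

/-! ### Convergence and coefficients of $F_P$. -/

section Product

theorem coeff_aeval_X_mul (P : Polynomial ℝ) (i : ℕ) (g : Series)
    (hg : ∀ m : ℕ →₀ ℕ, m i ≠ 0 → MvPowerSeries.coeff m g = 0) (m : ℕ →₀ ℕ) :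
    MvPowerSeries.coeff m (Polynomial.aeval (MvPowerSeries.X i : Series) P * g)
      = P.coeff (m i) * MvPowerSeries.coeff (m.erase i) g := by
  induction P using Polynomial.induction_on' with
  | add p q hp hq => rw [map_add, add_mul, map_add, hp, hq, Polynomial.coeff_add, add_mul]
  | monomial n a =>
    rw [Polynomial.aeval_monomial, mul_assoc, MvPowerSeries.X_pow_eq, Polynomial.coeff_monomial,
      ← Algebra.smul_def, MvPowerSeries.coeff_smul, MvPowerSeries.coeff_monomial_mul, one_mul]
    simp only [Finsupp.single_le_iff]
    rcases lt_trichotomy n (m i) with h | h | h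
    · rw [if_pos h.le, if_neg h.ne, hg, mul_zero, zero_mul]
      simp
      omega
    · rw [if_pos h.le, if_pos h]
      refine congrArg (fun m' => a * MvPowerSeries.coeff m' g) ?_
      ext k
      by_cases hk : k = i
      · simp [hk, h]
      · simp [Finsupp.erase_ne hk, Finsupp.single_eq_of_ne hk]
    · rw [if_neg h.not_ge, if_neg h.ne', mul_zero, zero_mul]

theorem coeff_prod_aeval_X (P : Polynomial ℝ) (s : Finset ℕ) (m : ℕ →₀ ℕ) :
    MvPowerSeries.coeff m (∏ i ∈ s, Polynomial.aeval (MvPowerSeries.X i : Series) P)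
      = if m.support ⊆ s then ∏ i ∈ s, P.coeff (m i) else 0 := by
  induction s using Finset.induction_on generalizing m with
  | empty =>
    rw [Finset.prod_empty, MvPowerSeries.coeff_one]
    simp
  | insert i s hi ih =>
    rw [Finset.prod_insert hi, coeff_aeval_X_mul, ih, Finset.prod_insert hi]
    · have h1 : (m.erase i).support ⊆ s ↔ m.support ⊆ insert i s := by
        rw [Finsupp.support_erase, Finset.subset_insert_iff]
      simp only [h1]
      split_ifs
      · congr 1
        refine Finset.prod_congr rfl fun j hj => ?_
        rw [Finsupp.erase_ne (ne_of_mem_of_not_mem hj hi)]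
      · simp
    · intro m' hm'
      rw [ih, if_neg]
      exact fun h => hi (h (Finsupp.mem_support_iff.2 hm'))

/-- The coefficient at `m` is constant once the finite product covers the support of `m`, as every
further factor contributes $a_0=1$. -/
theorem hasProd_aeval_X {P : Polynomial ℝ} (h0 : P.coeff 0 = 1) :
    HasProd (fun i : ℕ => Polynomial.aeval (MvPowerSeries.X i : Series) P)
      (fun m => ∏ i ∈ m.support, P.coeff (m i) : Series) := by
  unfold HasProd
  rw [SummationFilter.unconditional_filter]
  refine (MvPowerSeries.WithPiTopology.tendsto_iff_coeff_tendsto _ _ _).2 fun m => ?_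
  refine tendsto_const_nhds.congr' ?_
  filter_upwards [Filter.eventually_ge_atTop m.support] with s hs
  rw [coeff_prod_aeval_X, if_pos hs]
  refine Finset.prod_subset hs fun i _ hi => ?_
  rw [Finsupp.notMem_support_iff.1 hi, h0]

theorem coeff_prodSeries {P : Polynomial ℝ} (h0 : P.coeff 0 = 1) (m : ℕ →₀ ℕ) :
    MvPowerSeries.coeff m (prodSeries P) = ∏ i ∈ m.support, P.coeff (m i) := by
  rw [prodSeries, (hasProd_aeval_X h0).tprod_eq]
  rfl

theorem symm_prodSeries {P : Polynomial ℝ} (h0 : P.coeff 0 = 1) : Symm (prodSeries P) := by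
  intro σ m
  rw [coeff_prodSeries h0, coeff_prodSeries h0]
  refine Finset.prod_bij (fun i _ => σ.symm i) ?_ ?_ ?_ ?_
  · intro i hi
    simpa [Finsupp.equivMapDomain_apply] using hi
  · intro i _ j _ h
    exact σ.symm.injective h
  · intro j hj
    exact ⟨σ j, by simpa [Finsupp.equivMapDomain_apply] using hj, by simp⟩
  · intro i _
    rw [Finsupp.equivMapDomain_apply]

end Product

/-! ### Existence and uniqueness of Schur expansions. -/

section Expansion

theorem finite_card_eq (n : ℕ) : {μ : YoungDiagram | μ.card = n}.Finite := by
  refine Set.Finite.of_injOn (f := YoungDiagram.cells)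
    (t := ((Finset.range n ×ˢ Finset.range n).powerset : Set (Finset (ℕ × ℕ)))) ?_ ?_
    (Finset.finite_toSet _)
  · rintro μ rfl
    rw [Finset.mem_coe, Finset.mem_powerset]
    rintro ⟨i, j⟩ h
    rw [YoungDiagram.mem_cells] at h
    have h1 : μ.colLen j ≤ μ.card := by
      rw [YoungDiagram.colLen_eq_card]
      exact Finset.card_le_card (Finset.filter_subset _ _)
    have h2 : μ.rowLen i ≤ μ.card := by
      rw [YoungDiagram.rowLen_eq_card]
      exact Finset.card_le_card (Finset.filter_subset _ _)
    rw [Finset.mem_product, Finset.mem_range, Finset.mem_range]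
    exact ⟨(YoungDiagram.mem_iff_lt_colLen.1 h).trans_le h1,
      (YoungDiagram.mem_iff_lt_rowLen.1 h).trans_le h2⟩
  · intro μ _ ν _ h
    exact YoungDiagram.ext h

/-- The partitions of `n`. -/
noncomputable def diagrams (n : ℕ) : Finset YoungDiagram := (finite_card_eq n).toFinset

theorem mem_diagrams {n : ℕ} {μ : YoungDiagram} : μ ∈ diagrams n ↔ μ.card = n := by
  simp [diagrams]

/-- By homogeneity only the finitely many partitions of `m.degree` contribute at `m`. -/
theorem hasSchurExpansion_iff (f : Series) (c : YoungDiagram → ℝ) :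
    HasSchurExpansion f c ↔ ∀ m : ℕ →₀ ℕ,
      ∑ μ ∈ diagrams m.degree, c μ * MvPowerSeries.coeff m (schur μ)
        = MvPowerSeries.coeff m f := by
  rw [HasSchurExpansion, MvPowerSeries.WithPiTopology.hasSum_iff_hasSum_coeff]
  refine forall_congr' fun m => ?_
  have h : HasSum (fun μ => MvPowerSeries.coeff m (c μ • schur μ))
      (∑ μ ∈ diagrams m.degree, c μ * MvPowerSeries.coeff m (schur μ)) := by
    simp only [MvPowerSeries.coeff_smul]
    refine hasSum_sum_of_ne_finset_zero fun μ hμ => ?_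
    by_contra hne
    exact hμ (mem_diagrams.2 (degree_eq_card_of_coeff_schur_ne_zero (right_ne_zero_of_mul hne)).symm)
  exact ⟨fun h' => h.unique h', fun h' => h' ▸ h⟩

theorem degree_rowExp (μ : YoungDiagram) : (rowExp μ).degree = μ.card :=
  degree_eq_card_of_coeff_schur_ne_zero (by rw [coeff_rowExp_schur_self]; exact one_ne_zero)

theorem exists_rowLen_eq {N : ℕ} (g : ℕ → ℕ) (hg : ∀ i j, i ≤ j → g j ≤ g i)
    (hN : ∀ i, N ≤ i → g i = 0) : ∃ μ : YoungDiagram, μ.rowLen = g := by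
  have hmem (c : ℕ × ℕ) : c ∈ (Finset.range N ×ˢ Finset.range (g 0)).filter (fun c => c.2 < g c.1) ↔
      c.2 < g c.1 := by
    simp only [Finset.mem_filter, Finset.mem_product, Finset.mem_range, and_iff_right_iff_imp]
    intro h
    refine ⟨?_, h.trans_le (hg 0 _ (Nat.zero_le _))⟩
    by_contra! h'
    rw [hN _ h'] at h
    omega
  refine ⟨⟨(Finset.range N ×ˢ Finset.range (g 0)).filter (fun c => c.2 < g c.1), ?_⟩, ?_⟩
  · intro a b hab ha
    rw [Finset.mem_coe, hmem] at ha ⊢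
    exact (hab.2.trans_lt ha).trans_le (hg _ _ hab.1)
  · funext i
    refine eq_of_forall_lt_iff fun j => ?_
    exact YoungDiagram.mem_iff_lt_rowLen.symm.trans (hmem (i, j))

theorem exists_equivMapDomain_eq_rowExp (m : ℕ →₀ ℕ) :
    ∃ (σ : Equiv.Perm ℕ) (ν : YoungDiagram), m.equivMapDomain σ = rowExp ν := by
  obtain ⟨N, hN⟩ : ∃ N, ∀ i, N ≤ i → m i = 0 := by
    refine ⟨m.support.sup id + 1, fun i hi => ?_⟩
    by_contra h
    have := Finset.le_sup (f := id) (Finsupp.mem_support_iff.2 h)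
    simp at this
    omega
  -- The order dual makes `Tuple.sort` arrange the exponents in decreasing order.
  let f : Fin N → ℕᵒᵈ := fun i => OrderDual.toDual (m i)
  have hmono := Tuple.monotone_sort f
  let τ : Equiv.Perm ℕ := (Tuple.sort f).extendDomain Fin.equivSubtype
  have hτ (i : Fin N) : τ i = Tuple.sort f i :=
    Equiv.Perm.extendDomain_apply_image (Tuple.sort f) Fin.equivSubtype i
  have hτ' (i : ℕ) (hi : N ≤ i) : τ i = i :=
    Equiv.Perm.extendDomain_apply_not_subtype _ _ (not_lt.2 hi)
  obtain ⟨ν, hν⟩ := exists_rowLen_eq (N := N) (fun i => m (τ i)) (fun i j hij => by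
    rcases lt_or_ge j N with hj | hj
    · have := hmono (show (⟨i, by omega⟩ : Fin N) ≤ ⟨j, hj⟩ from hij)
      rw [show τ i = _ from hτ ⟨i, by omega⟩, show τ j = _ from hτ ⟨j, hj⟩]
      exact this
    · rw [hτ' j hj, hN j hj]
      exact Nat.zero_le _) (fun i hi => by rw [hτ' i hi, hN i hi])
  refine ⟨τ.symm, ν, ?_⟩
  ext i
  rw [rowExp_apply, hν, Finsupp.equivMapDomain_apply, Equiv.symm_symm]

theorem Symm.hasSchurExpansion_iff {f : Series} (hf : Symm f) (c : YoungDiagram → ℝ) :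
    HasSchurExpansion f c ↔ ∀ ν : YoungDiagram,
      ∑ μ ∈ diagrams ν.card, c μ * MvPowerSeries.coeff (rowExp ν) (schur μ)
        = MvPowerSeries.coeff (rowExp ν) f := by
  rw [TwoSchur.hasSchurExpansion_iff]
  constructor
  · intro h ν
    rw [← h, degree_rowExp]
  · intro h m
    obtain ⟨σ, ν, hν⟩ := exists_equivMapDomain_eq_rowExp m
    have hdeg : m.degree = ν.card := by
      rw [← degree_rowExp, ← hν, Finsupp.equivMapDomain_eq_mapDomain, Finsupp.degree_mapDomain]
    rw [← hf σ m, hν, ← h ν, hdeg]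
    refine Finset.sum_congr rfl fun μ _ => ?_
    rw [← hν, symm_schur]

theorem existsUnique_solution (n : ℕ) (b : YoungDiagram → ℝ) :
    ∃! d : {μ // μ ∈ diagrams n} → ℝ, ∀ ν : {μ // μ ∈ diagrams n},
      ∑ μ, d μ * MvPowerSeries.coeff (rowExp ν.1) (schur μ.1) = b ν.1 := by
  let _ : LinearOrder {μ // μ ∈ diagrams n} :=
    LinearOrder.lift' (fun μ => toLex μ.1.rowLen) fun μ ν h =>
      Subtype.ext (rowLen_injective (toLex.injective h))
  let A : Matrix {μ // μ ∈ diagrams n} {μ // μ ∈ diagrams n} ℝ :=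
    Matrix.of fun ν μ => MvPowerSeries.coeff (rowExp ν.1) (schur μ.1)
  have hdet : A.det = 1 := by
    rw [Matrix.det_of_isUpperTriangular]
    · exact Finset.prod_eq_one fun μ _ => coeff_rowExp_schur_self μ.1
    · intro ν μ hlt
      by_contra hne
      exact absurd (toLex_rowLen_le_of_coeff_schur_ne_zero hne) (not_le.2 hlt)
  have hunit : IsUnit A.det := by rw [hdet]; exact isUnit_one
  have key (d : {μ // μ ∈ diagrams n} → ℝ) : (∀ ν : {μ // μ ∈ diagrams n},
      ∑ μ, d μ * MvPowerSeries.coeff (rowExp ν.1) (schur μ.1) = b ν.1) ↔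
      A.mulVec d = fun ν => b ν.1 := by
    rw [funext_iff]
    refine forall_congr' fun ν => ?_
    simp only [Matrix.mulVec, dotProduct, A, Matrix.of_apply, mul_comm]
  simp only [key]
  refine ⟨A⁻¹.mulVec fun ν => b ν.1, ?_, fun d hd => ?_⟩
  · simp only [Matrix.mulVec_mulVec, Matrix.mul_nonsing_inv _ hunit, Matrix.one_mulVec]
  · rw [← hd, Matrix.mulVec_mulVec, Matrix.nonsing_inv_mul _ hunit, Matrix.one_mulVec]

theorem Symm.existsUnique_hasSchurExpansion {f : Series} (hf : Symm f) :
    ∃! c : YoungDiagram → ℝ, HasSchurExpansion f c := by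
  have hsum (c : YoungDiagram → ℝ) : HasSchurExpansion f c ↔
      ∀ n, ∀ ν : {μ // μ ∈ diagrams n},
        ∑ μ : {μ // μ ∈ diagrams n}, c μ.1 * MvPowerSeries.coeff (rowExp ν.1) (schur μ.1)
          = MvPowerSeries.coeff (rowExp ν.1) f := by
    rw [hf.hasSchurExpansion_iff]
    constructor
    · intro h n ν
      rw [← h, mem_diagrams.1 ν.2]
      exact Finset.sum_coe_sort (diagrams n) fun μ =>
        c μ * MvPowerSeries.coeff (rowExp ν.1) (schur μ)
    · intro h ν
      rw [← h ν.card ⟨ν, mem_diagrams.2 rfl⟩]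
      exact (Finset.sum_coe_sort (diagrams ν.card) fun μ =>
        c μ * MvPowerSeries.coeff (rowExp ν) (schur μ)).symm
  choose d hd hd' using fun n =>
    existsUnique_solution n (fun ν => MvPowerSeries.coeff (rowExp ν) f)
  refine ⟨fun μ => d μ.card ⟨μ, mem_diagrams.2 rfl⟩, ?_, fun c hc => ?_⟩
  · refine (hsum _).2 fun n ν => ?_
    rw [← hd n ν]
    refine Finset.sum_congr rfl fun μ _ => ?_
    obtain ⟨μ, hμ⟩ := μ
    obtain rfl := mem_diagrams.1 hμ
    rfl
  · funext μ
    exact congrFun (hd' μ.card (fun ν => c ν.1) ((hsum c).1 hc μ.card)) ⟨μ, mem_diagrams.2 rfl⟩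

end Expansion

/-! ### Coefficients of Schur functions with at most two rows. -/

section TwoRows

theorem esymmInt_two_of_lt (k : ℤ) (hk : 2 < k) : esymmInt 2 k = 0 := by
  lift k to ℕ using by omega
  rw [esymmInt_natCast, MvPolynomial.esymm, Finset.powersetCard_eq_empty.2, Finset.sum_empty]
  simpa using hk

open MvPolynomial in
theorem sub_mul_jt_esymmInt_two (q a : ℕ) (α : ℕ → ℤ)
    (hα2 : ∀ i < q, α i = 2) (hα1 : ∀ i, q ≤ i → i < q + a → α i = 1) :
    (X 0 - X 1 : MvPolynomial (Fin 2) ℝ) * jt (esymmInt 2) α (q + a)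
      = (X 0 * X 1) ^ q * (X 0 ^ (a + 1) - X 1 ^ (a + 1)) := by
  refine sub_mul_jt_two_one (esymmInt_zero 2) ?_ ?_ (fun k hk => esymmInt_of_neg 2 hk)
    esymmInt_two_of_lt q a α hα2 hα1
  · rw [show (1 : ℤ) = ((1 : ℕ) : ℤ) from rfl, esymmInt_natCast, esymm_one, Fin.sum_univ_two]
  · rw [show (2 : ℤ) = ((2 : ℕ) : ℤ) from rfl, esymmInt_natCast, esymm,
      show Finset.powersetCard 2 (Finset.univ : Finset (Fin 2)) = {Finset.univ} from
        Finset.powersetCard_self _, Finset.sum_singleton, Fin.prod_univ_two]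

/-- The exponent vector of `x_0 ^ i * x_1 ^ j`. -/
noncomputable def pairExp (i j : ℕ) : Fin 2 →₀ ℕ := Finsupp.single 0 i + Finsupp.single 1 j

theorem pairExp_inj {i j k l : ℕ} : pairExp i j = pairExp k l ↔ i = k ∧ j = l := by
  constructor
  · intro h
    have h0 := DFunLike.congr_fun h 0
    have h1 := DFunLike.congr_fun h 1
    simp [pairExp] at h0 h1
    exact ⟨h0, h1⟩
  · rintro ⟨rfl, rfl⟩
    rfl

open MvPolynomial in
theorem X_pow_mul_X_pow (i j : ℕ) :
    (X 0 ^ i * X 1 ^ j : MvPolynomial (Fin 2) ℝ) = monomial (pairExp i j) 1 := by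
  rw [X_pow_eq_monomial, X_pow_eq_monomial, monomial_mul, one_mul, pairExp]

open MvPolynomial in
theorem coeff_sub_mul (i j : ℕ) (g : MvPolynomial (Fin 2) ℝ) :
    coeff (pairExp (i + 1) j) ((X 0 - X 1) * g) = coeff (pairExp i j) g
      - if j = 0 then 0 else coeff (pairExp (i + 1) (j - 1)) g := by
  rw [sub_mul, coeff_sub, coeff_X_mul', coeff_X_mul', if_pos (by simp [pairExp])]
  congr 1
  · congr 1
    ext k
    fin_cases k <;> simp [pairExp]
  · rcases j with _ | j
    · simp [pairExp]
    · rw [if_pos (by simp [pairExp]), if_neg (Nat.succ_ne_zero j)]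
      congr 1
      ext k
      fin_cases k <;> simp [pairExp]

/-- The coefficient of `x_0 ^ (i + 1) * x_1 ^ j` in `(x_0 - x_1) * f(x_0, x_1)`. -/
noncomputable def alternant (i j : ℕ) (f : Series) : ℝ :=
  MvPowerSeries.coeff ((pairExp i j).embDomain Fin.valEmbedding) f
    - if j = 0 then 0 else
      MvPowerSeries.coeff ((pairExp (i + 1) (j - 1)).embDomain Fin.valEmbedding) f

open Classical in
theorem alternant_schur (μ ν : YoungDiagram) (hν : ν.rowLen 2 = 0) :
    alternant (ν.rowLen 0) (ν.rowLen 1) (schur μ) = if μ = ν then 1 else 0 := by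
  rw [alternant, coeff_schur_eq_coeff_jt, coeff_schur_eq_coeff_jt, ← coeff_sub_mul]
  have hconj := conjugate_colLen_rowLen μ
  rcases Nat.eq_zero_or_pos (μ.rowLen 2) with h2 | h2
  · obtain ⟨a, ha⟩ := Nat.exists_eq_add_of_le (μ.rowLen_anti 0 1 zero_le_one)
    have hle := ν.rowLen_anti 0 1 zero_le_one
    rw [ha, sub_mul_jt_esymmInt_two]
    · have hexp : (MvPolynomial.X 0 * MvPolynomial.X 1) ^ μ.rowLen 1 *
          (MvPolynomial.X 0 ^ (a + 1) - MvPolynomial.X 1 ^ (a + 1) : MvPolynomial (Fin 2) ℝ)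
          = MvPolynomial.monomial (pairExp (μ.rowLen 0 + 1) (μ.rowLen 1)) 1
            - MvPolynomial.monomial (pairExp (μ.rowLen 1) (μ.rowLen 0 + 1)) 1 := by
        rw [← X_pow_mul_X_pow, ← X_pow_mul_X_pow, ha]
        ring
      have hiff : μ = ν ↔ μ.rowLen 0 + 1 = ν.rowLen 0 + 1 ∧ μ.rowLen 1 = ν.rowLen 1 := by
        refine ⟨fun h => by simp [h], fun h => rowLen_injective (funext fun i => ?_)⟩
        rcases i with _ | _ | i
        · omega
        · exact h.2
        · have h3 := μ.rowLen_anti 2 (i + 1 + 1) (by omega)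
          have h4 := ν.rowLen_anti 2 (i + 1 + 1) (by omega)
          omega
      rw [hexp, MvPolynomial.coeff_sub, MvPolynomial.coeff_monomial, MvPolynomial.coeff_monomial,
        -- The negative monomial has its first exponent below its second, the reverse of the
        -- exponent being read off.
        if_neg (show ¬pairExp (μ.rowLen 1) (μ.rowLen 0 + 1) = _ from fun h => by
          have := pairExp_inj.1 h
          omega), sub_zero]
      simp only [pairExp_inj, hiff]
    · intro i hi
      have h3 := (hconj i 1).2 hi
      have h4 := mt (hconj i 2).1 (by omega)
      omega
    · intro i hi hi'
      have h3 := mt (hconj i 1).1 (by omega)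
      have h4 := (hconj i 0).2 (by omega)
      omega
  · have hne : μ ≠ ν := by
      rintro rfl
      omega
    have h3 := (hconj 0 2).2 h2
    rw [jt_eq_zero_of_lt esymmInt_two_of_lt (by exact_mod_cast h3)
      (h2.trans_le (μ.rowLen_anti 0 2 (Nat.zero_le 2))), mul_zero, MvPolynomial.coeff_zero,
      if_neg hne]

theorem degree_embDomain_pairExp (i j : ℕ) :
    ((pairExp i j).embDomain Fin.valEmbedding).degree = i + j := by
  rw [Finsupp.embDomain_eq_mapDomain, Finsupp.degree_mapDomain, pairExp, map_add,
    Finsupp.degree_single, Finsupp.degree_single]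

/-- The functional `alternant` is dual to the Schur functions at `ν`. The formula holds for any
expansion, so the choice made in `schurCoeff` does not matter. -/
theorem HasSchurExpansion.eq_alternant {f : Series} {c : YoungDiagram → ℝ}
    (h : HasSchurExpansion f c) (ν : YoungDiagram) (hν : ν.rowLen 2 = 0) :
    c ν = alternant (ν.rowLen 0) (ν.rowLen 1) f := by
  classical
  have hc := (hasSchurExpansion_iff f c).1 h
  have hsum : alternant (ν.rowLen 0) (ν.rowLen 1) f
      = ∑ μ ∈ diagrams (ν.rowLen 0 + ν.rowLen 1),
        c μ * alternant (ν.rowLen 0) (ν.rowLen 1) (schur μ) := by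
    -- Both exponents in `alternant` have the same degree, so both coefficients expand over the same
    -- finite set of diagrams.
    simp only [alternant, mul_sub, Finset.sum_sub_distrib, ← hc, degree_embDomain_pairExp]
    split_ifs with h0
    · simp
    · rw [show ν.rowLen 0 + 1 + (ν.rowLen 1 - 1) = ν.rowLen 0 + ν.rowLen 1 by omega]
  have hcard : ν.card = ν.rowLen 0 + ν.rowLen 1 := by
    obtain ⟨m, hm, hm'⟩ := exists_embDomain_eq (N := 2) (rowExp ν) fun i hi =>
      Nat.le_zero.1 (hν ▸ ν.rowLen_anti 2 i hi)
    have hpair : m = pairExp (ν.rowLen 0) (ν.rowLen 1) := by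
      ext k
      rw [hm', rowExp_apply]
      fin_cases k <;> simp [pairExp]
    rw [← degree_rowExp, ← hm, hpair, degree_embDomain_pairExp]
  simp only [alternant_schur _ _ hν, mul_ite, mul_one, mul_zero] at hsum
  rw [hsum, Finset.sum_ite_eq', if_pos (mem_diagrams.2 hcard)]

theorem coeff_pairExp_prodSeries {P : Polynomial ℝ} (h0 : P.coeff 0 = 1) (i j : ℕ) :
    MvPowerSeries.coeff ((pairExp i j).embDomain Fin.valEmbedding) (prodSeries P)
      = P.coeff i * P.coeff j := by
  rw [coeff_prodSeries h0, Finsupp.support_embDomain, Finset.prod_map]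
  simp only [Finsupp.embDomain_apply_self]
  rw [Finset.prod_subset (Finset.subset_univ _), Fin.prod_univ_two]
  · simp [pairExp]
  · intro k _ hk
    rw [Finsupp.notMem_support_iff.1 hk, h0]

theorem schurCoeff_prodSeries {P : Polynomial ℝ} (h0 : P.coeff 0 = 1) (ν : YoungDiagram)
    (hν : ν.rowLen 2 = 0) :
    schurCoeff ν (prodSeries P) = P.coeff (ν.rowLen 0) * P.coeff (ν.rowLen 1)
      - if ν.rowLen 1 = 0 then 0 else P.coeff (ν.rowLen 0 + 1) * P.coeff (ν.rowLen 1 - 1) := by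
  have h : ∃ c, HasSchurExpansion (prodSeries P) c :=
    (symm_prodSeries h0).existsUnique_hasSchurExpansion.exists
  rw [schurCoeff, dif_pos h, h.choose_spec.eq_alternant ν hν, alternant,
    coeff_pairExp_prodSeries h0, coeff_pairExp_prodSeries h0]

theorem rowLen_twoRow (k : ℕ) :
    (twoRow k).rowLen 0 = k ∧ (twoRow k).rowLen 1 = k ∧ (twoRow k).rowLen 2 = 0 := by
  refine ⟨YoungDiagram.rowLen_ofRowLens (w := [k, k]) 0,
    YoungDiagram.rowLen_ofRowLens (w := [k, k]) 1, ?_⟩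
  by_contra h
  have := YoungDiagram.mem_iff_lt_rowLen.2 (Nat.pos_of_ne_zero h)
  rw [twoRow, YoungDiagram.mem_ofRowLens] at this
  simp at this

end TwoRows

/-! ### From log-concavity to strong log-concavity and nonnegativity. -/

section LogConcavity

variable {P : Polynomial ℝ}

theorem LogConcave.mul_succ_le (h : LogConcave P) (hpos : ∀ i : ℕ, i ≤ P.natDegree → 0 < P.coeff i)
    {i j : ℕ} (hij : i ≤ j) (hj : j + 1 ≤ P.natDegree) :
    P.coeff i * P.coeff (j + 1) ≤ P.coeff (i + 1) * P.coeff j := by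
  induction j, hij using Nat.le_induction with
  | base => rw [mul_comm]
  | succ j hij ih =>
    have h1 := ih (by omega)
    have h2 := h (j + 1) (by omega) hj
    rw [Nat.add_sub_cancel] at h2
    have hj0 := hpos j (by omega)
    have hj1 := hpos (j + 1) (by omega)
    have hi := hpos i (by omega)
    -- Multiplying by the positive $a_ja_{j+1}$ replaces division in the comparison of consecutive
    -- ratios.
    refine le_of_mul_le_mul_left ?_ (mul_pos hj0 hj1)
    calc P.coeff j * P.coeff (j + 1) * (P.coeff i * P.coeff (j + 1 + 1))
        = (P.coeff i * P.coeff (j + 1)) * (P.coeff j * P.coeff (j + 1 + 1)) := by ring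
      _ ≤ (P.coeff (i + 1) * P.coeff j) * P.coeff (j + 1) ^ 2 := by
        have := mul_pos hj0 (hpos (j + 1 + 1) hj)
        have := mul_pos (hpos (i + 1) (by omega)) hj0
        gcongr
      _ = P.coeff j * P.coeff (j + 1) * (P.coeff (i + 1) * P.coeff (j + 1)) := by ring

theorem LogConcave.stronglyLogConcave (h : LogConcave P)
    (hpos : ∀ i : ℕ, i ≤ P.natDegree → 0 < P.coeff i) : StronglyLogConcave P := by
  -- Both indices move inward one unit at a time, `r` times in all.
  have key (r p n : ℕ) (hpn : p + r ≤ n) (hq : n + r ≤ P.natDegree) :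
      P.coeff p * P.coeff (n + r) ≤ P.coeff (p + r) * P.coeff n := by
    induction r generalizing p with
    | zero => exact le_rfl
    | succ r ih =>
      refine (h.mul_succ_le hpos (i := p) (j := n + r) (by omega) (by omega)).trans ?_
      have := ih (p + 1) (by omega) (by omega)
      rwa [show p + 1 + r = p + (r + 1) by ring] at this
  intro p m n q hpm hmn hnq hq hsum
  have := key (m - p) p n (by omega) (by omega)
  rwa [show n + (m - p) = q by omega, show p + (m - p) = m by omega] at this

theorem StronglyLogConcave.schurCoeff_nonneg (h : StronglyLogConcave P) (h0 : P.coeff 0 = 1)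
    (hpos : ∀ i : ℕ, i ≤ P.natDegree → 0 < P.coeff i) (ν : YoungDiagram) (hν : ν.rowLen 2 = 0) :
    0 ≤ schurCoeff ν (prodSeries P) := by
  have hnonneg (i : ℕ) : 0 ≤ P.coeff i := by
    rcases le_or_gt i P.natDegree with hi | hi
    · exact (hpos i hi).le
    · rw [Polynomial.coeff_eq_zero_of_natDegree_lt hi]
  rw [schurCoeff_prodSeries h0 ν hν, sub_nonneg]
  have hle := ν.rowLen_anti 0 1 zero_le_one
  split_ifs with h1
  · exact mul_nonneg (hnonneg _) (hnonneg _)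
  · rcases le_or_gt (ν.rowLen 0 + 1) P.natDegree with hi | hi
    · rw [mul_comm, mul_comm (P.coeff (ν.rowLen 0))]
      exact h _ _ _ _ (by omega) hle (by omega) hi (by omega)
    -- Beyond the degree the subtracted product vanishes.
    · rw [Polynomial.coeff_eq_zero_of_natDegree_lt hi, zero_mul]
      exact mul_nonneg (hnonneg _) (hnonneg _)

end LogConcavity

end TwoSchur

theorem mainTheorem1 (P : Polynomial ℝ) (h0 : P.coeff 0 = 1)
    (hpos : ∀ i : ℕ, i ≤ P.natDegree → 0 < P.coeff i) :
    Multipliable (fun i : ℕ => Polynomial.aeval (MvPowerSeries.X i : TwoSchur.Series) P) ∧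
    (∃! c : YoungDiagram → ℝ, TwoSchur.HasSchurExpansion (TwoSchur.prodSeries P) c) ∧
    List.TFAE [
      ∀ μ : YoungDiagram, μ.rowLens.length ≤ 2 →
        0 ≤ TwoSchur.schurCoeff μ (TwoSchur.prodSeries P),
      ∀ k : ℕ, 1 ≤ k → 0 ≤ TwoSchur.schurCoeff (TwoSchur.twoRow k) (TwoSchur.prodSeries P),
      TwoSchur.LogConcave P,
      TwoSchur.StronglyLogConcave P] := by
  refine ⟨(TwoSchur.hasProd_aeval_X h0).multipliable,
    (TwoSchur.symm_prodSeries h0).existsUnique_hasSchurExpansion, ?_⟩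
  tfae_have 1 → 2 := fun h k hk => by
    refine h _ ?_
    rw [YoungDiagram.length_rowLens]
    by_contra! hlt
    have := (TwoSchur.conjugate_colLen_rowLen _ 0 2).1 hlt
    rw [(TwoSchur.rowLen_twoRow k).2.2] at this
    exact this.false
  tfae_have 2 → 3 := fun h j hj _ => by
    have := h j hj
    obtain ⟨e0, e1, e2⟩ := TwoSchur.rowLen_twoRow j
    rw [TwoSchur.schurCoeff_prodSeries h0 _ e2, e0, e1, if_neg (by omega), sub_nonneg] at this
    rwa [sq, mul_comm (P.coeff (j - 1))]
  tfae_have 3 → 4 := fun h => h.stronglyLogConcave hpos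
  tfae_have 4 → 1 := fun h μ hμ => by
    rw [YoungDiagram.length_rowLens] at hμ
    exact h.schurCoeff_nonneg h0 hpos μ (TwoSchur.rowLen_eq_zero_of_le μ hμ)
  tfae_finish
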